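/- Call a topological ring $\Lambda$ (associative, with unit, not necessarily commutative) an \emph{adic ring} if it is compact (and Hausdorff) and its Jacobson radical is open and finitely generated. For a ring $R$ let $K_1(R)=\mathrm{GL}(R)^{\mathrm{ab}}$, where $\mathrm{GL}(R)=\varinjlim_n \mathrm{GL}_n(R)$, and for a topological ring $R$ let $$\widehat K_1(R)=\varprojlim_{I} K_1(R/I),$$ where $I$ runs through the open two-sided ideals of $R$. For an adic ring $\Lambda$ put $$\Lambda\langle T\rangle=\varprojlim_{I}\,(\Lambda/I)[T],$$ where $I$ runs through the open two-sided ideals of $\Lambda$, the variable $T$ commutes with the coefficients, and $\Lambda\langle T\rangle$ carries the inverse limit topology, each $(\Lambda/I)[T]$ being discrete. Let $\Lambda$ be an adic ring. Then both of the natural homomorphisms $$\Lambda\langle T\rangle^\times\longrightarrow K_1(\Lambda\langle T\rangle)\longrightarrow \widehat K_1(\Lambda\langle T\rangle)$$ are surjective; here the first sends a unit $u$ to the class of the $1\times 1$ matrix $(u)$, and the second is induced by the projections $\Lambda\langle T\rangle\to\Lambda\langle T\rangle/I$. -/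

import Mathlib

universe u v w

noncomputable section

/-! ### The functor `K₁` -/

section MatrixStabilization

variable {R : Type u} [Ring R]

/-- The matrix `diag(A, 1)` of size `m`, for a matrix `A` of size `n ≤ m`. -/
def stabMatrix (n m : ℕ) (A : Matrix (Fin n) (Fin n) R) : Matrix (Fin m) (Fin m) R :=
  Matrix.of fun i j =>
    if h : i.val < n ∧ j.val < n then A ⟨i.val, h.1⟩ ⟨j.val, h.2⟩ else if i = j then 1 else 0

theorem stabMatrix_one (n m : ℕ) :
    stabMatrix n m (1 : Matrix (Fin n) (Fin n) R) = 1 := by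
  ext i j
  simp only [stabMatrix, Matrix.of_apply, Matrix.one_apply, Fin.ext_iff]
  split_ifs <;> rfl

theorem stabMatrix_mul {n m : ℕ} (h : n ≤ m) (A B : Matrix (Fin n) (Fin n) R) :
    stabMatrix n m (A * B) = stabMatrix n m A * stabMatrix n m B := by
  ext i j
  rw [Matrix.mul_apply]
  by_cases hi : i.val < n
  · by_cases hj : j.val < n
    · have hsum : ∑ k : Fin m, stabMatrix n m A i k * stabMatrix n m B k j =
          ∑ k : Fin n, A ⟨i, hi⟩ k * B k ⟨j, hj⟩ := by
        symm
        refine Finset.sum_of_injOn (Fin.castLE h) (Fin.castLE_injective h).injOn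
          (fun _ _ => Finset.mem_coe.2 (Finset.mem_univ _)) ?_ ?_
        · intro k _ hk
          have hkn : ¬ k.val < n := fun hlt => hk ⟨⟨k, hlt⟩, Finset.mem_coe.2 (Finset.mem_univ _), rfl⟩
          have hik : i ≠ k := by rintro rfl; exact hkn hi
          simp [stabMatrix, hkn, hik]
        · intro k _
          simp [stabMatrix, hi, hj]
      rw [hsum]
      simp [stabMatrix, hi, hj, Matrix.mul_apply]
    · rw [Finset.sum_eq_single j]
      · have hij : i ≠ j := by rintro rfl; exact hj hi
        simp [stabMatrix, hj, hij]
      · intro k _ hk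
        simp [stabMatrix, hj, hk]
      · simp
  · rw [Finset.sum_eq_single i]
    · simp [stabMatrix, hi]
    · intro k _ hk
      simp [stabMatrix, hi, hk.symm]
    · simp

/-- The stabilization homomorphism `GL_n(R) → GL_m(R)`, `A ↦ diag(A, 1)`, for `n ≤ m`. -/
def stabGL (R : Type u) [Ring R] (n m : ℕ) (h : n ≤ m) :
    Matrix.GeneralLinearGroup (Fin n) R →* Matrix.GeneralLinearGroup (Fin m) R :=
  Units.map
    { toFun := stabMatrix n m
      map_one' := stabMatrix_one n m
      map_mul' := stabMatrix_mul h }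

instance stabGL_directedSystem (R : Type u) [Ring R] :
    DirectedSystem (fun n : ℕ => Matrix.GeneralLinearGroup (Fin n) R)
      (fun n m h => stabGL R n m h) where
  map_self n A := by
    ext i j
    simp [stabGL, stabMatrix]
  map_map {k j i} hij hjk A := by
    ext a b
    simp only [stabGL, stabMatrix, Units.coe_map, MonoidHom.coe_mk, OneHom.coe_mk,
      Matrix.of_apply, Fin.ext_iff]
    grind

end MatrixStabilization

/-- The stable general linear group `GL(R) = colim_n GL_n(R)`. -/
abbrev StableGL (R : Type u) [Ring R] : Type u :=
  DirectLimit (fun n : ℕ => Matrix.GeneralLinearGroup (Fin n) R) (stabGL R)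

/-- `K₁(R) = GL(R)ᵃᵇ`. -/
abbrev K1 (R : Type u) [Ring R] : Type u := Abelianization (StableGL R)

/-- The homomorphism `GL_n(R) → GL(R)`. -/
def StableGL.of (R : Type u) [Ring R] (n : ℕ) :
    Matrix.GeneralLinearGroup (Fin n) R →* StableGL R where
  toFun A := (⟦⟨n, A⟩⟧ : DirectLimit _ (stabGL R))
  map_one' := (DirectLimit.one_def n).symm
  map_mul' A B := (DirectLimit.mul_def (f := stabGL R) n A B).symm

/-- The homomorphism `GL_n(R) → GL_n(S)` induced by a ring homomorphism `R → S`. -/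
def mapGL {R : Type u} {S : Type v} [Ring R] [Ring S] (f : R →+* S) (n : ℕ) :
    Matrix.GeneralLinearGroup (Fin n) R →* Matrix.GeneralLinearGroup (Fin n) S :=
  Units.map (f.mapMatrix : Matrix (Fin n) (Fin n) R →+* Matrix (Fin n) (Fin n) S).toMonoidHom

theorem stabGL_mapGL {R : Type u} {S : Type v} [Ring R] [Ring S] (f : R →+* S)
    (n m : ℕ) (h : n ≤ m) (A : Matrix.GeneralLinearGroup (Fin n) R) :
    stabGL S n m h (mapGL f n A) = mapGL f m (stabGL R n m h A) := by
  ext i j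
  simp only [stabGL, mapGL, stabMatrix, Units.coe_map, MonoidHom.coe_mk, OneHom.coe_mk,
    Matrix.of_apply, RingHom.toMonoidHom_eq_coe, MonoidHom.coe_coe, RingHom.mapMatrix_apply,
    Matrix.map_apply]
  split_ifs <;> simp

/-- The homomorphism `GL(R) → GL(S)` induced by a ring homomorphism `R → S`. -/
def StableGL.map {R : Type u} {S : Type v} [Ring R] [Ring S] (f : R →+* S) :
    StableGL R →* StableGL S where
  toFun := DirectLimit.map (stabGL R) (stabGL S) (fun n A => mapGL f n A) (stabGL_mapGL f)
  map_one' := by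
    rw [DirectLimit.one_def 0, DirectLimit.map_def, DirectLimit.one_def 0, map_one]
  map_mul' := DirectLimit.induction₂ _ fun n A B => by
    rw [DirectLimit.mul_def, DirectLimit.map_def, DirectLimit.map_def, DirectLimit.map_def,
      DirectLimit.mul_def, map_mul]

/-- Functoriality of `K₁`. -/
def K1.map {R : Type u} {S : Type v} [Ring R] [Ring S] (f : R →+* S) : K1 R →* K1 S :=
  Abelianization.map (StableGL.map f)

theorem K1.map_comp_apply {R : Type u} {S : Type v} {T : Type w} [Ring R] [Ring S] [Ring T]
    (g : S →+* T) (f : R →+* S) (x : K1 R) : K1.map g (K1.map f x) = K1.map (g.comp f) x := by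
  obtain ⟨y, rfl⟩ := QuotientGroup.mk_surjective x
  induction y using DirectLimit.induction with
  | ih n A => rfl

/-- The homomorphism `Rˣ → K₁(R)` sending a unit to the class of the `1 × 1` matrix it defines. -/
def K1.ofUnits (R : Type u) [Ring R] : Rˣ →* K1 R :=
  (Abelianization.of.comp (StableGL.of R 1)).comp
    (Units.map (Matrix.scalar (Fin 1) : R →+* Matrix (Fin 1) (Fin 1) R).toMonoidHom)

/-! ### Completed `K₁` -/

/-- The lattice of open two-sided ideals of a topological ring, ordered by inclusion. -/
abbrev OpenIdeal (R : Type u) [Ring R] [TopologicalSpace R] : Type u :=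
  {I : Ideal R // I.IsTwoSided ∧ IsOpen (I : Set R)}

instance OpenIdeal.isTwoSided {R : Type u} [Ring R] [TopologicalSpace R] (I : OpenIdeal R) :
    I.1.IsTwoSided := I.2.1

/-- The projection `R / I → R / J` for open two-sided ideals `I ⊆ J`. -/
def OpenIdeal.proj {R : Type u} [Ring R] [TopologicalSpace R] {I J : OpenIdeal R} (h : I ≤ J) :
    R ⧸ I.1 →+* R ⧸ J.1 :=
  Ideal.Quotient.factor h

/-- The completed `K`-group `K̂₁(R) = lim_I K₁(R / I)`, where `I` runs through the open two-sided
ideals of `R`, realized as the group of compatible families. -/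
def CompletedK1 (R : Type u) [Ring R] [TopologicalSpace R] :
    Subgroup ((I : OpenIdeal R) → K1 (R ⧸ I.1)) where
  carrier := {x | ∀ (I J : OpenIdeal R) (h : I ≤ J), K1.map (OpenIdeal.proj h) (x I) = x J}
  one_mem' := fun I J h => map_one _
  mul_mem' := fun {x y} hx hy I J h => by
    rw [Pi.mul_apply, Pi.mul_apply, map_mul, hx I J h, hy I J h]
  inv_mem' := fun {x} hx I J h => by
    rw [Pi.inv_apply, Pi.inv_apply, map_inv, hx I J h]

/-- The canonical homomorphism `K₁(R) → K̂₁(R)`. -/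
def K1.toCompleted (R : Type u) [Ring R] [TopologicalSpace R] : K1 R →* CompletedK1 R where
  toFun x := ⟨fun I => K1.map (Ideal.Quotient.mk I.1) x, fun I J h => by
    rw [K1.map_comp_apply, OpenIdeal.proj, Ideal.Quotient.factor_comp_mk]⟩
  map_one' := Subtype.ext (funext fun I => map_one _)
  map_mul' x y := Subtype.ext (funext fun I => map_mul _ x y)

/-! ### Adic rings and the ring `Λ⟨T⟩` -/

/-- A topological ring is an adic ring if it is compact (and Hausdorff) and its Jacobson radical is
open and finitely generated. -/
structure IsAdicRing (Λ : Type u) [Ring Λ] [TopologicalSpace Λ] : Prop where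
  isTopologicalRing : IsTopologicalRing Λ
  compactSpace : CompactSpace Λ
  t2Space : T2Space Λ
  isOpen_jacobson : IsOpen (Ring.jacobson Λ : Set Λ)
  fg_jacobson : (Ring.jacobson Λ).FG

/-- The ring `Λ⟨T⟩ = lim_I (Λ / I)[T]`, where `I` runs through the open two-sided ideals of `Λ`,
as a subring of the product of the polynomial rings `(Λ / I)[T]`. -/
def talgSubring (Λ : Type u) [Ring Λ] [TopologicalSpace Λ] :
    Subring ((I : OpenIdeal Λ) → Polynomial (Λ ⧸ I.1)) where
  carrier := {f | ∀ (I J : OpenIdeal Λ) (h : I ≤ J), (f I).map (OpenIdeal.proj h) = f J}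
  one_mem' := fun I J h => Polynomial.map_one _
  zero_mem' := fun I J h => Polynomial.map_zero _
  mul_mem' := fun {f g} hf hg I J h => by
    rw [Pi.mul_apply, Pi.mul_apply, Polynomial.map_mul, hf I J h, hg I J h]
  add_mem' := fun {f g} hf hg I J h => by
    rw [Pi.add_apply, Pi.add_apply, Polynomial.map_add, hf I J h, hg I J h]
  neg_mem' := fun {f} hf I J h => by
    rw [Pi.neg_apply, Pi.neg_apply, Polynomial.map_neg, hf I J h]

/-- The type of elements of `Λ⟨T⟩`. -/
def Talg (Λ : Type u) [Ring Λ] [TopologicalSpace Λ] : Type u := talgSubring Λ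

instance Talg.instRing (Λ : Type u) [Ring Λ] [TopologicalSpace Λ] : Ring (Talg Λ) :=
  inferInstanceAs (Ring (talgSubring Λ))

/-- The projection `Λ⟨T⟩ → (Λ / I)[T]`. -/
def Talg.proj {Λ : Type u} [Ring Λ] [TopologicalSpace Λ] (I : OpenIdeal Λ) :
    Talg Λ →+* Polynomial (Λ ⧸ I.1) :=
  (Pi.evalRingHom (fun I : OpenIdeal Λ => Polynomial (Λ ⧸ I.1)) I).comp (talgSubring Λ).subtype

/-- The inverse limit topology on `Λ⟨T⟩`, each `(Λ / I)[T]` being discrete: the coarsest topology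
for which all projections to the discrete rings `(Λ / I)[T]` are continuous. -/
instance Talg.instTopologicalSpace (Λ : Type u) [Ring Λ] [TopologicalSpace Λ] :
    TopologicalSpace (Talg Λ) :=
  ⨅ I : OpenIdeal Λ, TopologicalSpace.induced (Talg.proj I) ⊥

instance Talg.instIsTopologicalRing (Λ : Type u) [Ring Λ] [TopologicalSpace Λ] :
    IsTopologicalRing (Talg Λ) := by
  have key : ∀ I : OpenIdeal Λ, @Continuous (Talg Λ) (Polynomial (Λ ⧸ I.1)) _ ⊥ (Talg.proj I) :=
    fun I => continuous_iInf_dom (i := I) continuous_induced_dom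
  refine { continuous_add := ?_, continuous_mul := ?_, continuous_neg := ?_ }
  · refine continuous_iInf_rng.2 fun I => continuous_induced_rng.2 ?_
    let _ : TopologicalSpace (Polynomial (Λ ⧸ I.1)) := ⊥
    have _ : DiscreteTopology (Polynomial (Λ ⧸ I.1)) := ⟨rfl⟩
    have h := ((key I).comp continuous_fst).add ((key I).comp continuous_snd)
    exact h.congr fun x => (map_add (Talg.proj I) x.1 x.2).symm
  · refine continuous_iInf_rng.2 fun I => continuous_induced_rng.2 ?_
    let _ : TopologicalSpace (Polynomial (Λ ⧸ I.1)) := ⊥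
    have _ : DiscreteTopology (Polynomial (Λ ⧸ I.1)) := ⟨rfl⟩
    have h := ((key I).comp continuous_fst).mul ((key I).comp continuous_snd)
    exact h.congr fun x => (map_mul (Talg.proj I) x.1 x.2).symm
  · refine continuous_iInf_rng.2 fun I => continuous_induced_rng.2 ?_
    let _ : TopologicalSpace (Polynomial (Λ ⧸ I.1)) := ⊥
    have _ : DiscreteTopology (Polynomial (Λ ⧸ I.1)) := ⟨rfl⟩
    exact (key I).neg.congr fun x => (map_neg (Talg.proj I) x).symm

end

/-!
Let `J` be the Jacobson radical of `Λ`, and write `A = Λ⟨T⟩`. The powers of `J` are open, because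
`J` is finitely generated, and they are cofinal among the open ideals of `Λ`, because the Jacobson
radical of a finite ring is nilpotent. Hence `A` is the limit of the rings `(Λ / Jⁿ)[T]`, and the
kernel of `A → (Λ / J)[T]` lies in the Jacobson radical of `A` (`Talg.isUnit_of_proj_eq_one`).

The ring `Λ / J` is finite and semisimple, so `(Λ / J)[T]` is a finite product of matrix rings over
polynomial rings `F[T]` over finite fields. As `F[T]` is Euclidean, Gaussian elimination writes
every invertible matrix over it as a product of transvections, which are commutators in sizes at
least `3`, and a diagonal matrix. Therefore `K₁((Λ / J)[T])` is represented by units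
(`UnitsGenerate.polynomial_of_finite_semisimple`).

Both surjectivity claims then follow from one lemma: if a surjection of rings `f : R → S` has its
kernel in the Jacobson radical, then every element of the kernel of `K₁(f)` is the class of a unit
`u` with `f u = 1` (`K1.exists_ofUnits_eq_of_map_eq_one`). Indeed `GL_n(R) → GL_n(S)` is surjective,
so products of commutators lift, and an element of the kernel of `K₁(f)` is represented by a matrix
congruent to `1`. Gaussian elimination applies to such a matrix, since its diagonal entries are
units.

Applied to `A → (Λ / J)[T]`, the lemma shows that `K₁(A)` is represented by units. Applied to
`A / 𝔞ₙ₊₁ → A / 𝔞ₙ`, where `𝔞ₙ` is the kernel of `A → (Λ / Jⁿ)[T]`, it allows to represent a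
compatible family in `K̂₁(A)` by units `uₙ` of `A` with `uₙ₊₁` congruent to `uₙ` modulo `𝔞ₙ`
(`Talg.exists_unit_lift`). Their limit is a unit of `A` whose class maps to the family.
-/

noncomputable section

/-! ### Matrices generated by transvections and diagonal matrices -/

section Elementary

open Matrix

variable {R : Type*} [Ring R]
variable {ι κ : Type*} [Fintype ι] [DecidableEq ι] [Fintype κ] [DecidableEq κ]

/-- The homomorphism sending a family of units to the invertible diagonal matrix it defines. -/
def diagonalUnits (ι : Type*) [Fintype ι] [DecidableEq ι] (R : Type*) [Ring R] :
    (ι → Rˣ) →* GL ι R where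
  toFun v := ⟨diagonal fun i => (v i : R), diagonal fun i => ((v i)⁻¹ : Rˣ), by simp, by simp⟩
  map_one' := by ext; simp
  map_mul' v w := by ext; simp [-mul_diagonal, -diagonal_mul]

theorem coe_diagonalUnits (v : ι → Rˣ) :
    (diagonalUnits ι R v : Matrix ι ι R) = diagonal fun i => (v i : R) := rfl

/-- The submonoid of matrices generated by the transvections and the diagonal matrices with entries
in the group `V` of units of `R`. -/
def elemMonoid (V : Subgroup Rˣ) (ι : Type*) [Fintype ι] [DecidableEq ι] :
    Submonoid (Matrix ι ι R) :=
  Submonoid.closure ({M | ∃ (i j : ι) (a : R), i ≠ j ∧ M = 1 + single i j a} ∪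
    {M | ∃ v : ι → Rˣ, (∀ i, v i ∈ V) ∧ M = diagonal fun i => (v i : R)})

variable {V : Subgroup Rˣ}

theorem transvection_mem_elemMonoid {i j : ι} (h : i ≠ j) (a : R) :
    1 + single i j a ∈ elemMonoid V ι :=
  Submonoid.subset_closure (Or.inl ⟨i, j, a, h, rfl⟩)

theorem diagonal_mem_elemMonoid {v : ι → Rˣ} (h : ∀ i, v i ∈ V) :
    (diagonal fun i => (v i : R)) ∈ elemMonoid V ι :=
  Submonoid.subset_closure (Or.inr ⟨v, h, rfl⟩)

theorem elemMonoid_induction {P : Matrix ι ι R → Prop} (one : P 1)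
    (mul : ∀ M N, P M → P N → P (M * N))
    (transv : ∀ (i j : ι) (a : R), i ≠ j → P (1 + single i j a))
    (diag : ∀ v : ι → Rˣ, (∀ i, v i ∈ V) → P (diagonal fun i => (v i : R)))
    {M : Matrix ι ι R} (hM : M ∈ elemMonoid V ι) : P M := by
  refine Submonoid.closure_induction ?_ one (fun M N _ _ => mul M N) hM
  rintro _ (⟨i, j, a, h, rfl⟩ | ⟨v, h, rfl⟩)
  exacts [transv i j a h, diag v h]

theorem submatrix_mem_elemMonoid (e : κ ≃ ι) {M : Matrix ι ι R} (hM : M ∈ elemMonoid V ι) :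
    M.submatrix e e ∈ elemMonoid V κ := by
  refine elemMonoid_induction (P := fun M => M.submatrix e e ∈ elemMonoid V κ) ?_ ?_ ?_ ?_ hM
  · simp [one_mem]
  · intro M N hM hN
    rw [← submatrix_mul_equiv M N e e e]
    exact mul_mem hM hN
  · intro i j a h
    have : (1 + single i j a).submatrix e e = 1 + single (e.symm i) (e.symm j) a := by
      ext k l
      simp [single_apply, one_apply, Equiv.symm_apply_eq]
    rw [this]
    exact transvection_mem_elemMonoid (by simpa using h) a
  · intro v h
    rw [submatrix_diagonal_equiv]
    exact diagonal_mem_elemMonoid (v := v ∘ e) fun i => h _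

theorem fromBlocks_diag_mem_elemMonoid {A : Matrix ι ι R} (hA : A ∈ elemMonoid V ι)
    {D : Matrix κ κ R} (hD : D ∈ elemMonoid V κ) :
    fromBlocks A 0 0 D ∈ elemMonoid V (ι ⊕ κ) := by
  have h1 : fromBlocks A 0 0 1 ∈ elemMonoid V (ι ⊕ κ) := by
    refine elemMonoid_induction
      (P := fun M => fromBlocks M 0 0 1 ∈ elemMonoid V (ι ⊕ κ)) ?_ ?_ ?_ ?_ hA
    · simp [one_mem]
    · intro M N hM hN
      simpa [fromBlocks_multiply] using mul_mem hM hN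
    · intro i j a h
      have : fromBlocks (1 + single i j a) 0 0 1 =
          (1 : Matrix (ι ⊕ κ) (ι ⊕ κ) R) + single (Sum.inl i) (Sum.inl j) a := by
        ext (k | k) (l | l) <;> simp [single_apply, one_apply]
      rw [this]
      exact transvection_mem_elemMonoid (by simpa using h) a
    · intro v h
      have : fromBlocks (diagonal fun i => (v i : R)) 0 0 1 =
          diagonal fun i => ((Sum.elim v 1 : ι ⊕ κ → Rˣ) i : R) := by
        ext (k | k) (l | l) <;> simp [diagonal_apply, one_apply]
      rw [this]
      refine diagonal_mem_elemMonoid ?_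
      rintro (i | i)
      exacts [h i, one_mem V]
  have h2 : fromBlocks 1 0 0 D ∈ elemMonoid V (ι ⊕ κ) := by
    refine elemMonoid_induction
      (P := fun M => fromBlocks 1 0 0 M ∈ elemMonoid V (ι ⊕ κ)) ?_ ?_ ?_ ?_ hD
    · simp [one_mem]
    · intro M N hM hN
      simpa [fromBlocks_multiply] using mul_mem hM hN
    · intro i j a h
      have : fromBlocks 1 0 0 (1 + single i j a) =
          (1 : Matrix (ι ⊕ κ) (ι ⊕ κ) R) + single (Sum.inr i) (Sum.inr j) a := by
        ext (k | k) (l | l) <;> simp [single_apply, one_apply]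
      rw [this]
      exact transvection_mem_elemMonoid (by simpa using h) a
    · intro v h
      have : fromBlocks 1 0 0 (diagonal fun i => (v i : R)) =
          diagonal fun i => ((Sum.elim 1 v : ι ⊕ κ → Rˣ) i : R) := by
        ext (k | k) (l | l) <;> simp [diagonal_apply, one_apply]
      rw [this]
      refine diagonal_mem_elemMonoid ?_
      rintro (i | i)
      exacts [one_mem V, h i]
  simpa [fromBlocks_multiply] using mul_mem h1 h2

theorem fromBlocks_upper_mem_elemMonoid (B : Matrix ι κ R) :
    fromBlocks 1 B 0 1 ∈ elemMonoid V (ι ⊕ κ) := by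
  induction B using Matrix.induction_on' with
  | h_zero => simp [one_mem]
  | h_add B C hB hC => simpa [fromBlocks_multiply, add_comm] using mul_mem hB hC
  | h_std_basis i j a =>
    have : fromBlocks 1 (single i j a) 0 1 =
        (1 : Matrix (ι ⊕ κ) (ι ⊕ κ) R) + single (Sum.inl i) (Sum.inr j) a := by
      ext (k | k) (l | l) <;> simp [single_apply, one_apply]
    rw [this]
    exact transvection_mem_elemMonoid (by simp) a

theorem fromBlocks_lower_mem_elemMonoid (C : Matrix κ ι R) :
    fromBlocks 1 0 C 1 ∈ elemMonoid V (ι ⊕ κ) := by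
  have := submatrix_mem_elemMonoid (Equiv.sumComm ι κ)
    (fromBlocks_upper_mem_elemMonoid (V := V) C)
  simpa using this

/-- Block Gauss decomposition: with an invertible lower right block `D`, a matrix is the product
of an upper unitriangular, a block diagonal and a lower unitriangular matrix. -/
theorem fromBlocks_eq_mul_schur (A : Matrix ι ι R) (B : Matrix ι κ R) (C : Matrix κ ι R)
    {D D' : Matrix κ κ R} (h : D * D' = 1) (h' : D' * D = 1) :
    fromBlocks A B C D =
      fromBlocks 1 (B * D') 0 1 * fromBlocks (A - B * D' * C) 0 0 D *
        fromBlocks 1 0 (D' * C) 1 := by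
  have e1 : B * D' * D = B := by rw [Matrix.mul_assoc, h', Matrix.mul_one]
  have e2 : D * (D' * C) = C := by rw [← Matrix.mul_assoc, h, Matrix.one_mul]
  have e3 : B * (D' * C) = B * D' * C := by rw [Matrix.mul_assoc]
  simp [fromBlocks_multiply, e1, e2, e3]

/-- Gaussian elimination: if the property `P` allows to write a matrix as an elementary matrix times
a matrix whose lower right corner is in `V`, in such a way that the Schur complement of that corner
has the property `P` again, then every matrix with property `P` is elementary. -/
theorem mem_elemMonoid_of_pivot (P : ∀ n : ℕ, Matrix (Fin n) (Fin n) R → Prop)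
    (pivot : ∀ (n : ℕ) (M : Matrix (Fin n ⊕ Fin 1) (Fin n ⊕ Fin 1) R),
      P (n + 1) (M.submatrix finSumFinEquiv.symm finSumFinEquiv.symm) →
      ∃ T ∈ elemMonoid V (Fin n ⊕ Fin 1), ∃ N, M = T * N ∧ ∃ d ∈ V,
        N (Sum.inr 0) (Sum.inr 0) = (d : R) ∧
        P n (N.toBlocks₁₁ - N.toBlocks₁₂ * diagonal (fun _ => (d⁻¹ : Rˣ) : Fin 1 → R) *
          N.toBlocks₂₁))
    (n : ℕ) (M : Matrix (Fin n) (Fin n) R) (hM : P n M) : M ∈ elemMonoid V (Fin n) := by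
  induction n with
  | zero => rw [Subsingleton.elim M 1]; exact one_mem _
  | succ n ih =>
    obtain ⟨T, hT, N, hN, d, hd, hNd, hP⟩ := pivot n (M.submatrix finSumFinEquiv finSumFinEquiv)
      (by simpa using hM)
    have hmem : N ∈ elemMonoid V (Fin n ⊕ Fin 1) := by
      have hD : N.toBlocks₂₂ = diagonal fun _ => (d : R) := by
        ext i j
        rw [Subsingleton.elim i 0, Subsingleton.elim j 0]
        simpa [toBlocks₂₂] using hNd
      rw [← fromBlocks_toBlocks N,
        fromBlocks_eq_mul_schur (D' := diagonal fun _ => ((d⁻¹ : Rˣ) : R)) _ _ _ (by simp [hD])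
          (by simp [hD])]
      refine mul_mem (mul_mem (fromBlocks_upper_mem_elemMonoid _) ?_)
        (fromBlocks_lower_mem_elemMonoid _)
      refine fromBlocks_diag_mem_elemMonoid (ih _ hP) ?_
      rw [hD]
      exact diagonal_mem_elemMonoid (v := fun _ => d) fun _ => hd
    have := submatrix_mem_elemMonoid finSumFinEquiv.symm (mul_mem hT hmem)
    rw [← hN] at this
    simpa using this

/-- A matrix congruent to `1` modulo an ideal contained in the Jacobson radical is elementary, with
diagonal parts congruent to `1` as well. The ideal is the kernel of `f`; the hypothesis `hf` says
that it lies in the Jacobson radical. -/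
theorem mem_elemMonoid_of_map_eq_one {S : Type*} [Ring S] (f : R →+* S)
    (hf : ∀ r, f r = 1 → IsUnit r) (n : ℕ) (M : Matrix (Fin n) (Fin n) R) (hM : M.map f = 1) :
    M ∈ elemMonoid (Units.map (f : R →* S)).ker (Fin n) := by
  refine mem_elemMonoid_of_pivot (fun n M => M.map f = 1) ?_ n M hM
  intro n M hM
  have hM' : M.map f = 1 := by
    have := congrArg (fun N => N.submatrix finSumFinEquiv finSumFinEquiv) hM
    simpa [← submatrix_map] using this
  have h00 : f (M (Sum.inr 0) (Sum.inr 0)) = 1 := by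
    simpa using congrFun (congrFun hM' (Sum.inr 0)) (Sum.inr 0)
  obtain ⟨d, hd⟩ := hf _ h00
  refine ⟨1, one_mem _, M, (one_mul M).symm, d, ?_, hd.symm, ?_⟩
  · rw [MonoidHom.mem_ker]
    ext
    simp [hd, h00]
  · ext i j
    have h1 := congrFun (congrFun hM' (Sum.inl i)) (Sum.inl j)
    have h2 := congrFun (congrFun hM' (Sum.inl i)) (Sum.inr 0)
    simp only [map_apply, one_apply, Sum.inl.injEq, reduceCtorEq, if_false] at h1 h2
    simp [mul_apply, toBlocks₁₁, toBlocks₁₂, toBlocks₂₁, h1, h2, one_apply]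

/-! ### Elementary matrices in the abelianized general linear group -/

/-- A transvection as an element of the general linear group. -/
def transvectionUnit {i j : ι} (h : i ≠ j) (a : R) : GL ι R where
  val := 1 + single i j a
  inv := 1 + single i j (-a)
  val_inv := by
    simp [mul_add, add_mul, single_mul_single_of_ne _ _ _ _ h.symm, ← single_add, add_assoc]
  inv_val := by
    simp [mul_add, add_mul, single_mul_single_of_ne _ _ _ _ h.symm, ← single_add, add_assoc]

theorem transvectionUnit_eq_commutator {i j k : ι} (hij : i ≠ j) (hik : i ≠ k) (hkj : k ≠ j)
    (a : R) : transvectionUnit hij a =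
      transvectionUnit hik a * transvectionUnit hkj (1 : R) * (transvectionUnit hik a)⁻¹ *
        (transvectionUnit hkj (1 : R))⁻¹ := by
  rw [eq_mul_inv_iff_mul_eq, eq_mul_inv_iff_mul_eq]
  ext1
  simp [transvectionUnit, mul_add, add_mul, single_mul_single_of_ne, hij.symm, hkj.symm]
  abel

theorem abelianization_transvectionUnit (hι : 3 ≤ Fintype.card ι) {i j : ι} (h : i ≠ j) (a : R) :
    Abelianization.of (transvectionUnit h a) = 1 := by
  obtain ⟨k, hk⟩ : ∃ k, k ∉ ({i, j} : Finset ι) := by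
    by_contra! hall
    have := Finset.card_le_card (fun x _ => hall x : Finset.univ ⊆ ({i, j} : Finset ι))
    rw [Finset.card_univ] at this
    exact absurd (this.trans Finset.card_le_two) (by omega)
  simp only [Finset.mem_insert, Finset.mem_singleton, not_or] at hk
  rw [transvectionUnit_eq_commutator h (Ne.symm hk.1) hk.2, map_mul, map_mul, map_mul,
    map_inv, map_inv]
  simp

/-- Permutation matrices as elements of the general linear group. -/
def permUnit (R : Type*) [Ring R] (σ : Equiv.Perm ι) : GL ι R where
  val := (1 : Matrix ι ι R).submatrix σ id
  inv := (1 : Matrix ι ι R).submatrix id σ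
  val_inv := by
    have := submatrix_mul_equiv (1 : Matrix ι ι R) (1 : Matrix ι ι R) σ (Equiv.refl ι) σ
    simpa using this
  inv_val := by simp

/-- A unit has the same class at every place of the diagonal. -/
theorem abelianization_diagonalUnits_mulSingle (i j : ι) (u : Rˣ) :
    Abelianization.of (diagonalUnits ι R (Pi.mulSingle i u)) =
      Abelianization.of (diagonalUnits ι R (Pi.mulSingle j u)) := by
  have h : permUnit R (Equiv.swap i j) * diagonalUnits ι R (Pi.mulSingle i u) =
      diagonalUnits ι R (Pi.mulSingle j u) * permUnit R (Equiv.swap i j) := by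
    ext k l
    simp only [permUnit, Units.val_mul, coe_diagonalUnits, mul_diagonal, diagonal_mul,
      submatrix_apply, one_apply, id, Pi.mulSingle_apply]
    by_cases hk : k = j
    · subst hk
      rcases eq_or_ne l i with rfl | hl
      · simp
      · simp [hl, hl.symm]
    · by_cases hl : l = i
      · subst hl
        have : Equiv.swap l j k ≠ l := by
          rw [Ne, Equiv.swap_apply_eq_iff, Equiv.swap_apply_left]; exact hk
        simp [this]
      · simp [hk, hl]
  have h' := congrArg Abelianization.of h
  rw [map_mul, map_mul, mul_comm] at h'
  exact mul_right_cancel h'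

/-- In sizes at least `3` transvections are commutators, and the diagonal entries of a diagonal
matrix can be collected in one place modulo commutators. -/
theorem exists_abelianization_of_mem_elemMonoid (hι : 3 ≤ Fintype.card ι) (i₀ : ι)
    {M : Matrix ι ι R} (hM : M ∈ elemMonoid V ι) :
    ∃ g : GL ι R, (g : Matrix ι ι R) = M ∧ ∃ v ∈ V,
      Abelianization.of g = Abelianization.of (diagonalUnits ι R (Pi.mulSingle i₀ v)) := by
  -- the classes of the matrices `diag(v, 1, …, 1)` with `v ∈ V`
  let c : Rˣ →* Abelianization (GL ι R) :=
    (Abelianization.of.comp (diagonalUnits ι R)).comp (MonoidHom.mulSingle (fun _ => Rˣ) i₀)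
  suffices h : ∃ g : GL ι R, (g : Matrix ι ι R) = M ∧ Abelianization.of g ∈ V.map c by
    obtain ⟨g, hg, v, hv, hgv⟩ := h
    exact ⟨g, hg, v, hv, hgv.symm⟩
  refine elemMonoid_induction
    (P := fun M => ∃ g : GL ι R, (g : Matrix ι ι R) = M ∧ Abelianization.of g ∈ V.map c)
    ?_ ?_ ?_ ?_ hM
  · exact ⟨1, rfl, by rw [map_one]; exact one_mem _⟩
  · rintro _ _ ⟨g, rfl, hg⟩ ⟨h, rfl, hh⟩
    exact ⟨g * h, rfl, by rw [map_mul]; exact mul_mem hg hh⟩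
  · intro i j a h
    exact ⟨transvectionUnit h a, rfl, by
      rw [abelianization_transvectionUnit hι]; exact one_mem _⟩
  · intro v hv
    refine ⟨diagonalUnits ι R v, rfl, ?_⟩
    refine Subgroup.pi_mem_of_mulSingle_mem
      (H := (V.map c).comap (Abelianization.of.comp (diagonalUnits ι R))) v fun i => ?_
    exact ⟨v i, hv i, abelianization_diagonalUnits_mulSingle i₀ i (v i)⟩

theorem isUnit_of_mem_elemMonoid {M : Matrix ι ι R} (hM : M ∈ elemMonoid V ι) :
    IsUnit M :=
  elemMonoid_induction isUnit_one (fun _ _ => IsUnit.mul)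
    (fun _ _ a h => (transvectionUnit h a).isUnit) (fun v _ => (diagonalUnits ι R v).isUnit) hM

theorem isUnit_of_isUnit_fromBlocks_diag {A : Matrix ι ι R} {D : Matrix κ κ R}
    (h : IsUnit (fromBlocks A 0 0 D)) : IsUnit A := by
  obtain ⟨⟨_, N, h1, h2⟩, rfl⟩ := h
  rw [← fromBlocks_toBlocks N, fromBlocks_multiply, ← fromBlocks_one, fromBlocks_inj] at h1 h2
  exact ⟨⟨A, N.toBlocks₁₁, by simpa using h1.1, by simpa using h2.1⟩, rfl⟩

/-- The Schur complement of an invertible corner of an invertible matrix is invertible. -/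
theorem isUnit_schur {M : Matrix (ι ⊕ κ) (ι ⊕ κ) R} (hM : IsUnit M) {D' : Matrix κ κ R}
    (h : M.toBlocks₂₂ * D' = 1) (h' : D' * M.toBlocks₂₂ = 1) :
    IsUnit (M.toBlocks₁₁ - M.toBlocks₁₂ * D' * M.toBlocks₂₁) := by
  rw [← fromBlocks_toBlocks M, fromBlocks_eq_mul_schur _ _ _ h h'] at hM
  have hu := isUnit_of_mem_elemMonoid
    (fromBlocks_upper_mem_elemMonoid (V := ⊤) (M.toBlocks₁₂ * D'))
  have hl := isUnit_of_mem_elemMonoid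
    (fromBlocks_lower_mem_elemMonoid (V := ⊤) (D' * M.toBlocks₂₁))
  obtain ⟨u, hu⟩ := hu
  obtain ⟨l, hl⟩ := hl
  rw [← hu, ← hl, Units.isUnit_mul_units, Units.isUnit_units_mul] at hM
  exact isUnit_of_isUnit_fromBlocks_diag hM

theorem one_add_single_mul_neg (i j : ι) (h : i ≠ j) (a : R) :
    (1 + single i j a) * (1 + single i j (-a)) = (1 : Matrix ι ι R) :=
  (transvectionUnit h a).mul_inv

theorem one_add_single_mul_apply (i j : ι) (a : R) (M : Matrix ι ι R) (l : ι) :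
    ((1 + single i j a) * M) i l = M i l + a * M j l := by
  simp [add_mul]

end Elementary

/-! ### Invertible matrices over Euclidean domains -/

section Euclidean

open Matrix

variable {R : Type*} [EuclideanDomain R] {ι : Type*} [Fintype ι] [DecidableEq ι]

/-- Over a Euclidean domain, every column of an invertible matrix can be brought by row operations
into a shape with a unit on the diagonal. -/
theorem exists_eq_mul_isUnit_apply {V : Subgroup Rˣ} (M : Matrix ι ι R) (hM : IsUnit M) (j₀ : ι) :
    ∃ T ∈ elemMonoid V ι, ∃ N, M = T * N ∧ IsUnit (N j₀ j₀) := by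
  obtain ⟨⟨M, M', hMM', hM'M⟩, rfl⟩ := hM
  -- a nonzero entry of minimal norm in the column, among all row equivalent matrices
  let s : Set R := {a | a ≠ 0 ∧ ∃ T ∈ elemMonoid V ι, ∃ N k, M = T * N ∧ N k j₀ = a}
  have hs : s.Nonempty := by
    by_contra hemp
    have hcol : ∀ k, M k j₀ = 0 := fun k => by
      by_contra hk
      exact hemp ⟨_, hk, 1, one_mem _, M, k, (one_mul M).symm, rfl⟩
    have := congrFun (congrFun hM'M j₀) j₀
    simp [mul_apply, hcol] at this
  obtain ⟨a, ⟨ha0, T, hT, N, k, hMTN, hNk⟩, hmin⟩ :=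
    EuclideanDomain.r_wellFounded.has_min s hs
  -- by minimality it divides the whole column, hence is a unit
  have hdvd : ∀ l, a ∣ N l j₀ := by
    intro l
    rcases eq_or_ne l k with rfl | hlk
    · exact dvd_of_eq hNk.symm
    rw [← EuclideanDomain.mod_eq_zero]
    by_contra hne
    refine hmin (N l j₀ % a) ⟨hne, T * (1 + single l k (N l j₀ / a)),
      mul_mem hT (transvection_mem_elemMonoid hlk _),
      (1 + single l k (-(N l j₀ / a))) * N, l, ?_, ?_⟩ (EuclideanDomain.mod_lt _ ha0)
    · rw [hMTN, Matrix.mul_assoc, ← Matrix.mul_assoc (1 + _), one_add_single_mul_neg _ _ hlk,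
        Matrix.one_mul]
    · rw [one_add_single_mul_apply, hNk, EuclideanDomain.mod_eq_sub_mul_div]
      ring
  have hunit : IsUnit a := by
    have h1 := congrFun (congrFun hM'M j₀) j₀
    rw [hMTN, ← Matrix.mul_assoc, mul_apply, one_apply_eq] at h1
    exact isUnit_of_dvd_one (h1 ▸ Finset.dvd_sum fun l _ => (hdvd l).mul_left _)
  rcases eq_or_ne j₀ k with rfl | hk
  · exact ⟨T, hT, N, hMTN, hNk ▸ hunit⟩
  -- adding a multiple of the row `k` turns the diagonal entry into `1`
  obtain ⟨b, hb⟩ := hunit.exists_left_inv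
  refine ⟨T * (1 + single j₀ k (-((1 - N j₀ j₀) * b))),
    mul_mem hT (transvection_mem_elemMonoid hk _),
    (1 + single j₀ k ((1 - N j₀ j₀) * b)) * N, ?_, ?_⟩
  · have := one_add_single_mul_neg j₀ k hk (-((1 - N j₀ j₀) * b))
    rw [neg_neg] at this
    change M = _
    rw [hMTN, Matrix.mul_assoc, ← Matrix.mul_assoc (1 + _), this, Matrix.one_mul]
  · rw [one_add_single_mul_apply, hNk, mul_assoc, hb, mul_one, add_sub_cancel]
    exact isUnit_one

/-- Euclidean domains are generalized Euclidean rings: the general linear groups are generated by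
transvections and diagonal matrices. -/
theorem mem_elemMonoid_of_isUnit {R : Type*} [EuclideanDomain R] {ι : Type*} [Fintype ι]
    [DecidableEq ι] {M : Matrix ι ι R} (hM : IsUnit M) :
    M ∈ elemMonoid (⊤ : Subgroup Rˣ) ι := by
  suffices h : ∀ n (M : Matrix (Fin n) (Fin n) R), IsUnit M → M ∈ elemMonoid (⊤ : Subgroup Rˣ) _ by
    let e := Fintype.equivFin ι
    have h1 : IsUnit (M.submatrix e.symm e.symm) := (isUnit_submatrix_equiv e.symm e.symm).2 hM
    simpa using submatrix_mem_elemMonoid e (h _ _ h1)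
  refine mem_elemMonoid_of_pivot (fun n M => IsUnit M) fun n M hM => ?_
  rw [isUnit_submatrix_equiv] at hM
  obtain ⟨T, hT, N, rfl, d, hd⟩ := exists_eq_mul_isUnit_apply (V := ⊤) M hM (Sum.inr 0)
  have hN : IsUnit N := by
    obtain ⟨t, ht⟩ := isUnit_of_mem_elemMonoid hT
    rwa [← ht, Units.isUnit_units_mul] at hM
  have hD : N.toBlocks₂₂ = diagonal fun _ => (d : R) := by
    ext i j
    rw [Subsingleton.elim i 0, Subsingleton.elim j 0]
    simp [toBlocks₂₂, hd]
  exact ⟨T, hT, N, rfl, d, trivial, hd.symm, isUnit_schur hN (by simp [hD]) (by simp [hD])⟩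

end Euclidean

/-! ### Rings whose general linear groups are generated by units and commutators -/

section UnitsGenerate

open Matrix Polynomial

/-- In all sizes at least `3`, every invertible matrix over `R` is a product of commutators and a
matrix `diag(1, …, 1, u, 1, …, 1)` with a unit `u` at a prescribed place. -/
def UnitsGenerate (R : Type*) [Ring R] : Prop :=
  ∀ (ι : Type) [Fintype ι] [DecidableEq ι], 3 ≤ Fintype.card ι → ∀ (i₀ : ι) (g : GL ι R),
    ∃ u : Rˣ, Abelianization.of g = Abelianization.of (diagonalUnits ι R (Pi.mulSingle i₀ u))

theorem UnitsGenerate.of_euclideanDomain (R : Type*) [EuclideanDomain R] : UnitsGenerate R := by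
  intro ι _ _ hι i₀ g
  obtain ⟨g', hg, v, -, h⟩ :=
    exists_abelianization_of_mem_elemMonoid hι i₀ (mem_elemMonoid_of_isUnit g.isUnit)
  exact ⟨v, by rw [← h, Units.ext hg]⟩

theorem UnitsGenerate.of_ringEquiv {R S : Type*} [Ring R] [Ring S] (e : R ≃+* S)
    (h : UnitsGenerate R) : UnitsGenerate S := by
  intro ι _ _ hι i₀ g
  let φ : GL ι R →* GL ι S := Units.map (e.toRingHom.mapMatrix : Matrix ι ι R →+* Matrix ι ι S)
  let ψ : GL ι S →* GL ι R :=
    Units.map (e.symm.toRingHom.mapMatrix : Matrix ι ι S →+* Matrix ι ι R)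
  obtain ⟨u, hu⟩ := h ι hι i₀ (ψ g)
  refine ⟨Units.map (e : R →* S) u, ?_⟩
  have := congrArg (Abelianization.map φ) hu
  rw [Abelianization.map_of, Abelianization.map_of] at this
  convert this using 2
  · ext; simp [φ, ψ]
  · ext i j
    simp only [φ, coe_diagonalUnits, diagonal_apply, Units.coe_map, MonoidHom.coe_coe,
      RingHom.mapMatrix_apply, map_apply, Pi.mulSingle_apply]
    split_ifs <;> simp

/-- Reduction of matrices over a matrix ring to bigger matrices over the base ring. -/
theorem UnitsGenerate.matrix {R : Type*} [EuclideanDomain R] (κ : Type) [Fintype κ] [DecidableEq κ]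
    [Nonempty κ] : UnitsGenerate (Matrix κ κ R) := by
  intro ι _ _ hι i₀ g
  obtain ⟨k₀⟩ := ‹Nonempty κ›
  let e : GL ι (Matrix κ κ R) ≃* GL (ι × κ) R :=
    Units.mapEquiv (compRingEquiv ι κ R).toMulEquiv
  have hcard : 3 ≤ Fintype.card (ι × κ) := by
    rw [Fintype.card_prod]
    have : 1 ≤ Fintype.card κ := Fintype.card_pos_iff.2 ⟨k₀⟩
    nlinarith
  obtain ⟨u, hu⟩ := UnitsGenerate.of_euclideanDomain R (ι × κ) hcard (i₀, k₀) (e g)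
  refine ⟨diagonalUnits κ R (Pi.mulSingle k₀ u), ?_⟩
  have := congrArg (Abelianization.map (e.symm : GL (ι × κ) R →* GL ι (Matrix κ κ R))) hu
  rw [Abelianization.map_of, Abelianization.map_of] at this
  convert this using 2
  · simp
  · rw [MonoidHom.coe_coe, MulEquiv.eq_symm_apply]
    ext ⟨i, k⟩ ⟨j, l⟩
    simp only [e, Units.coe_mapEquiv, RingEquiv.toMulEquiv_eq_coe, RingEquiv.coe_toMulEquiv,
      compRingEquiv_apply, comp_apply, coe_diagonalUnits, diagonal_apply, Pi.mulSingle_apply,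
      Prod.mk.injEq]
    by_cases hij : i = j <;> by_cases hkl : k = l <;> by_cases hi : i = i₀ <;>
      by_cases hk : k = k₀ <;>
      simp_all [coe_diagonalUnits, Pi.mulSingle_apply, one_apply]

/-- The commutator subgroup of a finite product of groups is the product of the commutator
subgroups. -/
theorem UnitsGenerate.pi {η : Type*} [Finite η] (R : η → Type*) [∀ s, Ring (R s)]
    (h : ∀ s, UnitsGenerate (R s)) : UnitsGenerate (∀ s, R s) := by
  intro ι _ _ hι i₀ g
  let gs : ∀ s, GL ι (R s) := fun s =>
    Units.map ((Pi.evalRingHom R s).mapMatrix : Matrix ι ι (∀ s, R s) →+* Matrix ι ι (R s)) g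
  choose u hu using fun s => h s ι hι i₀ (gs s)
  -- the general linear group of a product is the product of the general linear groups
  let φ : (∀ s, GL ι (R s)) →* GL ι (∀ s, R s) :=
    { toFun := fun x => ⟨of fun i j s => (x s : Matrix ι ι (R s)) i j,
        of fun i j s => ((x s)⁻¹ : GL ι (R s)).val i j,
        by
          ext i j s
          have := congrFun (congrFun (x s).mul_inv i) j
          simpa [mul_apply, one_apply, ite_apply] using this,
        by
          ext i j s
          have := congrFun (congrFun (x s).inv_mul i) j
          simpa [mul_apply, one_apply, ite_apply] using this⟩
      map_one' := by ext i j s; simp [one_apply, ite_apply]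
      map_mul' := fun x y => by ext i j s; simp [mul_apply] }
  let ds : ∀ s, GL ι (R s) := fun s => diagonalUnits ι (R s) (Pi.mulSingle i₀ (u s))
  have hmem : gs * ds⁻¹ ∈ commutator (∀ s, GL ι (R s)) := by
    have hpi := Subgroup.commutator_pi_pi_of_finite (fun s => (⊤ : Subgroup (GL ι (R s))))
      (fun s => ⊤)
    rw [Subgroup.pi_top] at hpi
    rw [commutator_def, hpi]
    intro s _
    change (gs * ds⁻¹) s ∈ commutator (GL ι (R s))
    rw [← Abelianization.ker_of, MonoidHom.mem_ker, Pi.mul_apply, map_mul,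
      Pi.inv_apply, map_inv, mul_inv_eq_one]
    exact hu s
  refine ⟨MulEquiv.piUnits.symm u, ?_⟩
  have hφ := Abelianization.commutator_subset_ker (Abelianization.of.comp φ) hmem
  rw [MonoidHom.mem_ker, map_mul, map_inv, mul_inv_eq_one, MonoidHom.comp_apply,
    MonoidHom.comp_apply] at hφ
  have hgs : φ gs = g := by ext i j s; rfl
  rw [hgs] at hφ
  rw [hφ]
  congr 1
  ext i j s
  simp only [φ, ds, coe_diagonalUnits, diagonal_apply, Pi.mulSingle_apply, MonoidHom.coe_mk,
    OneHom.coe_mk, of_apply]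
  split_ifs <;> simp

theorem UnitsGenerate.matrix_polynomial (F : Type*) [Field F] (κ : Type) [Fintype κ]
    [DecidableEq κ] [Nonempty κ] : UnitsGenerate (Matrix κ κ F)[X] :=
  .of_ringEquiv (matPolyEquiv (R := F) (n := κ)).toRingEquiv (.matrix κ)

/-- By the theorems of Wedderburn–Artin and Wedderburn, `S[X]` is a product of matrix rings over
polynomial rings over finite fields. -/
theorem UnitsGenerate.polynomial_of_finite_semisimple (S : Type*) [Ring S] [Finite S]
    [IsSemisimpleRing S] : UnitsGenerate S[X] := by
  obtain ⟨n, D, d, _, hd, ⟨e⟩⟩ := IsSemisimpleRing.exists_ringEquiv_pi_matrix_divisionRing S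
  have hfin : ∀ i, Finite (D i) := fun i => by
    refine Finite.of_surjective (fun s : S => e s i 0 0) fun x => ?_
    exact ⟨e.symm (Pi.single i (diagonal fun _ => x)), by simp⟩
  refine .of_ringEquiv ((Polynomial.piEquiv _).symm.trans (Polynomial.mapEquiv e.symm))
    (.pi _ fun i => ?_)
  let _ : Field (D i) := littleWedderburn (D i)
  exact .matrix_polynomial (D i) (Fin (d i))

end UnitsGenerate

/-! ### The group `K₁` -/

section StableGL

open Matrix

variable {R : Type u} [Ring R]

theorem StableGL.of_stabGL {n m : ℕ} (h : n ≤ m) (A : GL (Fin n) R) :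
    StableGL.of R m (stabGL R n m h A) = StableGL.of R n A :=
  Quotient.sound ⟨m, le_rfl, h, DirectedSystem.map_self' (stabGL R) _⟩

theorem StableGL.exists_of_eq (x : StableGL R) : ∃ n A, StableGL.of R n A = x := by
  obtain ⟨n, A, rfl⟩ := DirectLimit.exists_eq_mk (stabGL R) x
  exact ⟨n, A, rfl⟩

theorem StableGL.exists_stabGL_eq {n : ℕ} {A B : GL (Fin n) R}
    (h : StableGL.of R n A = StableGL.of R n B) :
    ∃ m, ∃ hm : n ≤ m, stabGL R n m hm A = stabGL R n m hm B := by
  obtain ⟨m, h1, h2, h3⟩ := Quotient.eq.1 h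
  exact ⟨m, h1, h3⟩

/-- The commutator subgroup of the stable general linear group is the union of the commutator
subgroups of the finite stages. -/
theorem StableGL.exists_mem_commutator {x : StableGL R} (hx : x ∈ commutator (StableGL R)) :
    ∃ n₀, ∀ n ≥ n₀, ∃ C ∈ commutator (GL (Fin n) R), StableGL.of R n C = x := by
  rw [commutator_eq_closure] at hx
  induction hx using Subgroup.closure_induction with
  | mem x hx =>
    obtain ⟨y, z, rfl⟩ := hx
    obtain ⟨m, A, B, rfl, rfl⟩ := DirectLimit.exists_eq_mk₂ (stabGL R) y z
    refine ⟨m, fun n hn => ⟨_, Subgroup.commutator_mem_commutator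
      (Subgroup.mem_top (stabGL R m n hn A)) (Subgroup.mem_top (stabGL R m n hn B)), ?_⟩⟩
    rw [map_commutatorElement, StableGL.of_stabGL, StableGL.of_stabGL]
    rfl
  | one => exact ⟨0, fun n _ => ⟨1, one_mem _, map_one _⟩⟩
  | mul x y _ _ hx hy =>
    obtain ⟨n₀, h₀⟩ := hx
    obtain ⟨n₁, h₁⟩ := hy
    refine ⟨max n₀ n₁, fun n hn => ?_⟩
    obtain ⟨C, hC, rfl⟩ := h₀ n (le_of_max_le_left hn)
    obtain ⟨D, hD, rfl⟩ := h₁ n (le_of_max_le_right hn)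
    exact ⟨C * D, mul_mem hC hD, map_mul _ _ _⟩
  | inv x _ hx =>
    obtain ⟨n₀, h₀⟩ := hx
    refine ⟨n₀, fun n hn => ?_⟩
    obtain ⟨C, hC, rfl⟩ := h₀ n hn
    exact ⟨C⁻¹, inv_mem hC, map_inv _ _⟩

theorem K1.exists_of_eq (x : K1 R) : ∃ n A, Abelianization.of (StableGL.of R n A) = x := by
  obtain ⟨y, rfl⟩ := QuotientGroup.mk_surjective x
  obtain ⟨n, A, rfl⟩ := StableGL.exists_of_eq y
  exact ⟨n, A, rfl⟩

theorem K1.of_eq_of_abelianization_eq {n : ℕ} {A B : GL (Fin n) R}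
    (h : Abelianization.of A = Abelianization.of B) :
    Abelianization.of (StableGL.of R n A) = Abelianization.of (StableGL.of R n B) := by
  simpa only [Abelianization.map_of] using congrArg (Abelianization.map (StableGL.of R n)) h

theorem K1.of_diagonalUnits_mulSingle {n : ℕ} (hn : 0 < n) (u : Rˣ) :
    Abelianization.of (StableGL.of R n (diagonalUnits (Fin n) R (Pi.mulSingle ⟨0, hn⟩ u))) =
      K1.ofUnits R u := by
  rw [K1.ofUnits, MonoidHom.comp_apply, MonoidHom.comp_apply, ← StableGL.of_stabGL hn]
  congr 2
  ext i j
  simp only [coe_diagonalUnits, stabGL, stabMatrix, Units.coe_map, MonoidHom.coe_mk,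
    OneHom.coe_mk, of_apply, diagonal_apply, Pi.mulSingle_apply, Fin.ext_iff]
  by_cases hi : i.val = 0 <;> by_cases hj : j.val = 0 <;> simp [hi, hj, eq_comm]

theorem UnitsGenerate.surjective_ofUnits (h : UnitsGenerate R) :
    Function.Surjective (K1.ofUnits R) := by
  intro x
  obtain ⟨n, A, rfl⟩ := K1.exists_of_eq x
  have hn : 0 < max n 3 := by omega
  obtain ⟨u, hu⟩ := h (Fin (max n 3)) (by simp) ⟨0, hn⟩ (stabGL R n _ (le_max_left _ _) A)
  refine ⟨u, ?_⟩
  rw [← K1.of_diagonalUnits_mulSingle hn, ← K1.of_eq_of_abelianization_eq hu, StableGL.of_stabGL]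

end StableGL

section Kernel

open Matrix

variable {R : Type u} {S : Type v} [Ring R] [Ring S]

theorem K1.map_of (f : R →+* S) (n : ℕ) (A : GL (Fin n) R) :
    K1.map f (Abelianization.of (StableGL.of R n A)) =
      Abelianization.of (StableGL.of S n (mapGL f n A)) := rfl

theorem K1.map_ofUnits (f : R →+* S) (u : Rˣ) :
    K1.map f (K1.ofUnits R u) = K1.ofUnits S (Units.map (f : R →* S) u) := by
  rw [K1.ofUnits, MonoidHom.comp_apply, MonoidHom.comp_apply, K1.map_of]
  simp only [K1.ofUnits, MonoidHom.comp_apply]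
  congr 2
  ext i j
  simp [mapGL, diagonal_apply, apply_ite f]

/-- Units lift along a surjection whose kernel lies in the Jacobson radical. -/
theorem isUnit_of_isUnit_map {f : R →+* S} (hf : Function.Surjective f)
    (hker : ∀ r, f r = 1 → IsUnit r) {r : R} (h : IsUnit (f r)) : IsUnit r := by
  obtain ⟨u, hu⟩ := h
  obtain ⟨s, hs⟩ := hf ((u⁻¹ : Sˣ) : S)
  obtain ⟨a, ha⟩ := hker (r * s) (by rw [map_mul, hs, ← hu, u.mul_inv])
  obtain ⟨b, hb⟩ := hker (s * r) (by rw [map_mul, hs, ← hu, u.inv_mul])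
  rw [isUnit_iff_exists_and_exists]
  exact ⟨⟨s * (a⁻¹ : Rˣ), by rw [← mul_assoc, ← ha, a.mul_inv]⟩,
    ⟨(b⁻¹ : Rˣ) * s, by rw [mul_assoc, ← hb, b.inv_mul]⟩⟩

theorem surjective_mapGL {f : R →+* S} (hf : Function.Surjective f)
    (hker : ∀ r, f r = 1 → IsUnit r) (n : ℕ) : Function.Surjective (mapGL f n) := by
  intro B
  have hF : Function.Surjective (f.mapMatrix : Matrix (Fin n) (Fin n) R →+* _) :=
    fun M => ⟨M.map (Function.surjInv hf), by ext; simp [Function.surjInv_eq]⟩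
  obtain ⟨M, hM⟩ := hF B
  obtain ⟨A, hA⟩ := isUnit_of_isUnit_map hF
    (fun N hN => isUnit_of_mem_elemMonoid (mem_elemMonoid_of_map_eq_one f hker n N hN))
    (hM ▸ B.isUnit)
  exact ⟨A, Units.ext ((congrArg f.mapMatrix hA).trans hM)⟩

/-- If the kernel of a surjection `f` lies in the Jacobson radical, then the kernel of `K₁(f)` is
represented by units. -/
theorem K1.exists_ofUnits_eq_of_map_eq_one {f : R →+* S} (hf : Function.Surjective f)
    (hker : ∀ r, f r = 1 → IsUnit r) {x : K1 R} (hx : K1.map f x = 1) :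
    ∃ u : Rˣ, f u = 1 ∧ K1.ofUnits R u = x := by
  obtain ⟨n, A, rfl⟩ := K1.exists_of_eq x
  rw [K1.map_of] at hx
  obtain ⟨n₀, h₀⟩ := StableGL.exists_mem_commutator
    ((Abelianization.ker_of (G := StableGL S)).le (MonoidHom.mem_ker.2 hx))
  obtain ⟨C, hC, hCA⟩ := h₀ (max n₀ (max n 3)) (le_max_left _ _)
  have hnm : n ≤ max n₀ (max n 3) := by omega
  rw [← StableGL.of_stabGL hnm] at hCA
  obtain ⟨m, hm, hstab⟩ := StableGL.exists_stabGL_eq hCA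
  -- at stage `m` the image of `A` is a product of commutators, which lifts to `R`
  have hnm' := hnm.trans hm
  have hmem : mapGL f m (stabGL R n m hnm' A) ∈ commutator (GL (Fin m) S) := by
    rw [← stabGL_mapGL]
    have h1 : stabGL S n m hnm' (mapGL f n A) = _ :=
      (DirectedSystem.map_map' (stabGL S) hnm hm (mapGL f n A)).symm
    rw [h1, ← hstab]
    have h2 := Subgroup.mem_map_of_mem (stabGL S _ m hm) hC
    rw [commutator_def, Subgroup.map_commutator] at h2
    exact Subgroup.commutator_mono le_top le_top h2
  have hlift : commutator (GL (Fin m) S) = (commutator (GL (Fin m) R)).map (mapGL f m) := by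
    rw [commutator_def, commutator_def, Subgroup.map_commutator,
      Subgroup.map_top_of_surjective _ (surjective_mapGL hf hker m)]
  rw [hlift] at hmem
  obtain ⟨D, hD, hDA⟩ := hmem
  have hone :
      ((stabGL R n m hnm' A * D⁻¹ : GL (Fin m) R) : Matrix (Fin m) (Fin m) R).map f = 1 := by
    have : mapGL f m (stabGL R n m hnm' A * D⁻¹) = 1 := by
      rw [map_mul, map_inv, hDA, mul_inv_cancel]
    exact congrArg Units.val this
  have hm0 : 0 < m := by omega
  obtain ⟨g, hg, u, hu, hgu⟩ := exists_abelianization_of_mem_elemMonoid (by simp; omega) ⟨0, hm0⟩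
    (mem_elemMonoid_of_map_eq_one f hker m _ hone)
  refine ⟨u, congrArg Units.val (MonoidHom.mem_ker.1 hu), ?_⟩
  rw [← K1.of_diagonalUnits_mulSingle hm0, ← K1.of_eq_of_abelianization_eq hgu, Units.ext hg,
    ← StableGL.of_stabGL hnm' A]
  refine K1.of_eq_of_abelianization_eq ?_
  rw [map_mul, map_inv, MonoidHom.mem_ker.1 ((Abelianization.ker_of (G := GL (Fin m) R)).ge hD),
    inv_one, mul_one]

/-- If the kernel of a surjection `f : R → S` lies in the Jacobson radical and `K₁(S)` is
represented by units, then so is `K₁(R)`. -/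
theorem K1.surjective_ofUnits_of_surjective {f : R →+* S} (hf : Function.Surjective f)
    (hker : ∀ r, f r = 1 → IsUnit r) (hS : Function.Surjective (K1.ofUnits S)) :
    Function.Surjective (K1.ofUnits R) := by
  intro x
  obtain ⟨v, hv⟩ := hS (K1.map f x)
  obtain ⟨r, hr⟩ := hf v
  obtain ⟨u, hu⟩ := isUnit_of_isUnit_map hf hker (hr ▸ v.isUnit)
  have huv : Units.map (f : R →* S) u = v := Units.ext (by simp [hu, hr])
  obtain ⟨w, -, hw⟩ := K1.exists_ofUnits_eq_of_map_eq_one hf hker (x := x * (K1.ofUnits R u)⁻¹)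
    (by rw [map_mul, map_inv, K1.map_ofUnits, huv, hv, mul_inv_cancel])
  exact ⟨w * u, by rw [map_mul, hw, inv_mul_cancel_right]⟩

end Kernel

/-! ### Powers of the Jacobson radical of an adic ring -/

section Adic

variable {Λ : Type u} [Ring Λ] [TopologicalSpace Λ]

/-- In a compact Hausdorff ring, the product of an open ideal and a finitely generated open ideal
is open: the ideal `N` is the image of a map `Λᵏ → N`, which is open by compactness, and the product
contains the image of `Iᵏ`. -/
theorem isOpen_ideal_mul [IsTopologicalRing Λ] [CompactSpace Λ] [T2Space Λ] {I N : Ideal Λ}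
    (hI : IsOpen (I : Set Λ)) (hN : IsOpen (N : Set Λ)) (hfg : N.FG) :
    IsOpen ((I * N : Ideal Λ) : Set Λ) := by
  obtain ⟨k, a, ha⟩ := Submodule.fg_iff_exists_fin_generating_family.1 hfg
  have haN : ∀ i, a i ∈ N := fun i => ha ▸ Submodule.subset_span ⟨i, rfl⟩
  let φ : (Fin k → Λ) →+ N :=
    { toFun := fun c => ⟨∑ i, c i * a i, sum_mem fun i _ => N.mul_mem_left _ (haN i)⟩
      map_zero' := by ext; simp
      map_add' := fun c d => by ext; simp [add_mul, Finset.sum_add_distrib] }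
  have hcont : Continuous φ := by
    refine Continuous.subtype_mk ?_ _
    fun_prop
  have hsurj : Function.Surjective φ := by
    rintro ⟨x, hx⟩
    obtain ⟨c, hc⟩ := (Submodule.mem_span_range_iff_exists_fun Λ).1 (ha ▸ hx)
    exact ⟨c, Subtype.ext hc⟩
  have hopen : IsOpenMap φ :=
    (AddMonoidHom.isOpenQuotientMap_of_isQuotientMap
      (hcont.isClosedMap.isQuotientMap hcont hsurj)).isOpenMap
  have h1 : IsOpen (Subtype.val '' (φ '' (Set.univ.pi fun _ => (I : Set Λ)))) :=
    hN.isOpenMap_subtype_val _ (hopen _ (isOpen_set_pi Set.finite_univ fun _ _ => hI))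
  refine AddSubgroup.isOpen_of_mem_nhds (I * N).toAddSubgroup (g := 0)
    (Filter.mem_of_superset (h1.mem_nhds ?_) ?_)
  · exact ⟨0, ⟨0, fun i _ => I.zero_mem, map_zero φ⟩, rfl⟩
  · rintro _ ⟨_, ⟨c, hc, rfl⟩, rfl⟩
    change ∑ i, c i * a i ∈ I * N
    exact sum_mem fun i _ => Ideal.mul_mem_mul (hc i trivial) (haN i)

theorem IsAdicRing.isOpen_jacobson_pow (hΛ : IsAdicRing Λ) (n : ℕ) :
    IsOpen ((Ring.jacobson Λ ^ n : Ideal Λ) : Set Λ) := by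
  have := hΛ.isTopologicalRing
  have := hΛ.compactSpace
  have := hΛ.t2Space
  induction n with
  | zero => simp [Submodule.pow_zero, Ideal.one_eq_top]
  | succ n ih =>
    rw [Ideal.IsTwoSided.pow_succ]
    exact isOpen_ideal_mul hΛ.isOpen_jacobson ih (Ideal.FG.pow hΛ.fg_jacobson)

/-- The powers of the Jacobson radical of an adic ring as open ideals. -/
def IsAdicRing.jacobsonPow (hΛ : IsAdicRing Λ) (n : ℕ) : OpenIdeal Λ :=
  ⟨Ring.jacobson Λ ^ n, inferInstance, hΛ.isOpen_jacobson_pow n⟩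

theorem IsAdicRing.jacobsonPow_anti (hΛ : IsAdicRing Λ) {m n : ℕ} (h : m ≤ n) :
    hΛ.jacobsonPow n ≤ hΛ.jacobsonPow m :=
  Ideal.pow_le_pow_right h

theorem IsAdicRing.finite_quotient (hΛ : IsAdicRing Λ) (I : OpenIdeal Λ) : Finite (Λ ⧸ I.1) := by
  have := hΛ.isTopologicalRing
  have := hΛ.compactSpace
  exact AddSubgroup.quotient_finite_of_isOpen I.1.toAddSubgroup I.2.2

/-- The powers of the Jacobson radical are cofinal among the open ideals, as the Jacobson radical
of a finite ring is nilpotent. -/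
theorem IsAdicRing.exists_jacobsonPow_le (hΛ : IsAdicRing Λ) (I : OpenIdeal Λ) :
    ∃ n, hΛ.jacobsonPow (n + 1) ≤ I := by
  have := hΛ.finite_quotient I
  obtain ⟨n, hn⟩ := IsArtinianRing.isNilpotent_jacobson_bot (R := Λ ⧸ I.1)
  rw [Ideal.jacobson_bot] at hn
  have key : ∀ m, ∀ x ∈ Ring.jacobson Λ ^ m,
      Ideal.Quotient.mk I.1 x ∈ Ring.jacobson (Λ ⧸ I.1) ^ m := by
    intro m
    induction m with
    | zero => simp [Submodule.pow_zero, Ideal.one_eq_top]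
    | succ m ih =>
      intro x hx
      rw [Submodule.pow_succ] at hx ⊢
      refine Submodule.mul_induction_on hx (fun a ha b hb => ?_) fun a b ha hb => ?_
      · rw [map_mul]
        have : RingHomSurjective (Ideal.Quotient.mk I.1) := ⟨Ideal.Quotient.mk_surjective⟩
        exact Ideal.mul_mem_mul (ih a ha) (Ring.le_comap_jacobson (Ideal.Quotient.mk I.1) hb)
      · rw [map_add]
        exact add_mem ha hb
  refine ⟨n, fun x hx => ?_⟩
  have := key n x (Ideal.pow_le_pow_right n.le_succ hx)
  rw [hn] at this
  exact Ideal.Quotient.eq_zero_iff_mem.1 this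

end Adic

/-! ### The ring `Λ⟨T⟩` -/

section Talg

open Polynomial

variable {Λ : Type u} [Ring Λ] [TopologicalSpace Λ]

theorem Talg.map_proj {I J : OpenIdeal Λ} (h : I ≤ J) (x : Talg Λ) :
    (Talg.proj I x).map (OpenIdeal.proj h) = Talg.proj J x := x.2 I J h

theorem Talg.ext {x y : Talg Λ} (h : ∀ I, Talg.proj I x = Talg.proj I y) : x = y :=
  Subtype.ext (funext h)

theorem Talg.exists_proj_eq (f : ∀ I : OpenIdeal Λ, (Λ ⧸ I.1)[X])
    (hf : ∀ (I J : OpenIdeal Λ) (h : I ≤ J), (f I).map (OpenIdeal.proj h) = f J) :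
    ∃ x : Talg Λ, ∀ I, Talg.proj I x = f I :=
  ⟨(⟨f, hf⟩ : talgSubring Λ), fun _ => rfl⟩

theorem Talg.proj_surjective (I : OpenIdeal Λ) : Function.Surjective (Talg.proj I) := by
  intro p
  obtain ⟨q, rfl⟩ := Polynomial.map_surjective _ Ideal.Quotient.mk_surjective p
  obtain ⟨x, hx⟩ := Talg.exists_proj_eq (fun I => q.map (Ideal.Quotient.mk I.1)) fun I J h => by
    rw [Polynomial.map_map, OpenIdeal.proj, Ideal.Quotient.factor_comp_mk]
  exact ⟨x, hx I⟩

theorem Talg.isUnit_of_forall_proj {x : Talg Λ} (h : ∀ I, IsUnit (Talg.proj I x)) : IsUnit x := by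
  choose u hu using h
  obtain ⟨y, hy⟩ := Talg.exists_proj_eq (fun I => ((u I)⁻¹ : (Λ ⧸ I.1)[X]ˣ).val) fun I J h => by
    have : Units.map (Polynomial.mapRingHom (OpenIdeal.proj h) : _ →* _) (u I) = u J :=
      Units.ext (by simp [hu, Talg.map_proj])
    rw [← this, ← map_inv]
    rfl
  exact ⟨⟨x, y, Talg.ext fun I => by rw [map_mul, map_one, hy, ← hu, Units.mul_inv],
    Talg.ext fun I => by rw [map_mul, map_one, hy, ← hu, Units.inv_mul]⟩, rfl⟩

theorem coeff_pow_mem_pow {R : Type*} [Ring R] {I : Ideal R} {p : R[X]} (h : ∀ i, p.coeff i ∈ I)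
    (n i : ℕ) : (p ^ n).coeff i ∈ I ^ n := by
  induction n generalizing i with
  | zero => simp [Submodule.pow_zero, Ideal.one_eq_top]
  | succ n ih =>
    rw [pow_succ, Polynomial.coeff_mul, Submodule.pow_succ]
    exact sum_mem fun x _ => Ideal.mul_mem_mul (ih _) (h _)

/-- The kernel of `Λ⟨T⟩ → (Λ / J)[T]`, with `J` the Jacobson radical of `Λ`, lies in the Jacobson
radical of `Λ⟨T⟩`: its image in each `(Λ / I)[T]` is nilpotent. -/
theorem Talg.isUnit_of_proj_eq_one (hΛ : IsAdicRing Λ) {x : Talg Λ}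
    (hx : Talg.proj (hΛ.jacobsonPow 1) x = 1) : IsUnit x := by
  refine Talg.isUnit_of_forall_proj fun I => ?_
  obtain ⟨n, hn⟩ := hΛ.exists_jacobsonPow_le I
  suffices h : IsUnit (Talg.proj (hΛ.jacobsonPow (n + 1)) x) by
    rw [← Talg.map_proj hn]
    exact h.map (Polynomial.mapRingHom (OpenIdeal.proj hn))
  obtain ⟨q, hq⟩ := Polynomial.map_surjective _ Ideal.Quotient.mk_surjective
    (1 - Talg.proj (hΛ.jacobsonPow (n + 1)) x)
  have hqJ : ∀ i, q.coeff i ∈ Ring.jacobson Λ := by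
    intro i
    have h1 := congrArg
      (Polynomial.map (OpenIdeal.proj (hΛ.jacobsonPow_anti (Nat.le_add_left 1 n)))) hq
    rw [Polynomial.map_map, Polynomial.map_sub, Talg.map_proj, hx, Polynomial.map_one, sub_self,
      OpenIdeal.proj, Ideal.Quotient.factor_comp_mk] at h1
    have h2 := congrArg (fun p => p.coeff i) h1
    simp only [coeff_map, coeff_zero] at h2
    simpa [IsAdicRing.jacobsonPow, Submodule.pow_one] using Ideal.Quotient.eq_zero_iff_mem.1 h2
  have hnil : IsNilpotent (1 - Talg.proj (hΛ.jacobsonPow (n + 1)) x) := by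
    refine ⟨n + 1, ?_⟩
    rw [← hq, ← Polynomial.map_pow]
    ext i
    rw [coeff_map, coeff_zero]
    exact Ideal.Quotient.eq_zero_iff_mem.2 (coeff_pow_mem_pow hqJ (n + 1) i)
  simpa using hnil.isUnit_one_sub

/-- The kernel of `Λ⟨T⟩ → (Λ / I)[T]` as an open ideal. -/
def Talg.kerProj (I : OpenIdeal Λ) : OpenIdeal (Talg Λ) :=
  ⟨RingHom.ker (Talg.proj I), inferInstance, by
    have h : @Continuous (Talg Λ) (Λ ⧸ I.1)[X] _ ⊥ (Talg.proj I) :=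
      continuous_iInf_dom (i := I) continuous_induced_dom
    exact @IsOpen.preimage _ _ _ ⊥ _ h {0} trivial⟩

theorem Talg.kerProj_mono {I J : OpenIdeal Λ} (h : I ≤ J) : Talg.kerProj I ≤ Talg.kerProj J := by
  intro x hx
  change Talg.proj J x = 0
  rw [← Talg.map_proj h, show Talg.proj I x = 0 from hx, Polynomial.map_zero]

theorem Talg.mk_kerProj_eq_iff {I : OpenIdeal Λ} {x y : Talg Λ} :
    Ideal.Quotient.mk (Talg.kerProj I).1 x = Ideal.Quotient.mk (Talg.kerProj I).1 y ↔
      Talg.proj I x = Talg.proj I y := by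
  rw [Ideal.Quotient.eq, Talg.kerProj, RingHom.mem_ker, map_sub, sub_eq_zero]

/-- The kernels of the projections to `(Λ / Jⁿ)[T]`, with `J` the Jacobson radical of `Λ`, are
cofinal among the open ideals of `Λ⟨T⟩`: a sequence with terms in these kernels converges to `0`. -/
theorem Talg.exists_kerProj_le (hΛ : IsAdicRing Λ) (𝔟 : OpenIdeal (Talg Λ)) :
    ∃ n, Talg.kerProj (hΛ.jacobsonPow (n + 1)) ≤ 𝔟 := by
  by_contra! hcon
  have hx : ∀ n, ∃ x, Talg.proj (hΛ.jacobsonPow (n + 1)) x = 0 ∧ x ∉ 𝔟.1 := fun n => by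
    obtain ⟨x, hx, hx'⟩ := Set.not_subset.1 (hcon n)
    exact ⟨x, hx, hx'⟩
  choose x hx hxb using hx
  have hlim : Filter.Tendsto x Filter.atTop (nhds 0) := by
    rw [nhds_iInf, Filter.tendsto_iInf]
    intro I
    let _ : TopologicalSpace (Λ ⧸ I.1)[X] := ⊥
    have _ : DiscreteTopology (Λ ⧸ I.1)[X] := ⟨rfl⟩
    rw [nhds_induced, Filter.tendsto_comap_iff, nhds_discrete, map_zero, Filter.tendsto_pure]
    obtain ⟨n, hn⟩ := hΛ.exists_jacobsonPow_le I
    filter_upwards [Filter.eventually_ge_atTop n] with m hm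
    rw [Function.comp_apply, ← Talg.map_proj ((hΛ.jacobsonPow_anti (Nat.succ_le_succ hm)).trans hn),
      hx, Polynomial.map_zero]
  obtain ⟨n, hn⟩ := (hlim.eventually (𝔟.2.2.mem_nhds 𝔟.1.zero_mem)).exists
  exact hxb n hn

end Talg

/-! ### `K₁` of `Λ⟨T⟩` -/

section Main

open Polynomial

variable {Λ : Type u} [Ring Λ] [TopologicalSpace Λ]

theorem IsAdicRing.unitsGenerate_polynomial (hΛ : IsAdicRing Λ) :
    UnitsGenerate (Λ ⧸ (hΛ.jacobsonPow 1).1)[X] := by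
  have := hΛ.finite_quotient (hΛ.jacobsonPow 1)
  have h : Ring.jacobson (Λ ⧸ (hΛ.jacobsonPow 1).1) = ⊥ := by
    have key : ∀ (K : Ideal Λ) [K.IsTwoSided], K = Ring.jacobson Λ →
        Ring.jacobson (Λ ⧸ K) = ⊥ := by
      rintro _ _ rfl
      exact Ring.jacobson_quotient_jacobson Λ
    exact key _ (Submodule.pow_one _)
  have := IsArtinianRing.isSemisimpleRing_iff_jacobson.2 h
  exact .polynomial_of_finite_semisimple _

theorem Talg.unitsGenerate_quotient (hΛ : IsAdicRing Λ) :
    UnitsGenerate (Talg Λ ⧸ (Talg.kerProj (hΛ.jacobsonPow 1)).1) :=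
  .of_ringEquiv (RingHom.quotientKerEquivOfSurjective (Talg.proj_surjective _)).symm
    hΛ.unitsGenerate_polynomial

theorem Talg.isUnit_of_mk_eq_one (hΛ : IsAdicRing Λ) (x : Talg Λ)
    (hx : Ideal.Quotient.mk (Talg.kerProj (hΛ.jacobsonPow 1)).1 x = 1) : IsUnit x := by
  rw [← map_one (Ideal.Quotient.mk _), Talg.mk_kerProj_eq_iff, map_one] at hx
  exact Talg.isUnit_of_proj_eq_one hΛ hx

theorem Talg.surjective_ofUnits (hΛ : IsAdicRing Λ) : Function.Surjective (K1.ofUnits (Talg Λ)) :=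
  K1.surjective_ofUnits_of_surjective Ideal.Quotient.mk_surjective (Talg.isUnit_of_mk_eq_one hΛ)
    (Talg.unitsGenerate_quotient hΛ).surjective_ofUnits

/-- A unit representing the component of a family in `K̂₁(Λ⟨T⟩)` modulo one power of the Jacobson
radical can be changed, without changing it modulo that power, so as to represent the component
modulo the next power. -/
theorem Talg.exists_unit_lift (hΛ : IsAdicRing Λ) (x : CompletedK1 (Talg Λ)) (n : ℕ) (u : (Talg Λ)ˣ)
    (hu : K1.map (Ideal.Quotient.mk (Talg.kerProj (hΛ.jacobsonPow (n + 1))).1)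
      (K1.ofUnits (Talg Λ) u) = x.1 (Talg.kerProj (hΛ.jacobsonPow (n + 1)))) :
    ∃ v : (Talg Λ)ˣ, K1.map (Ideal.Quotient.mk (Talg.kerProj (hΛ.jacobsonPow (n + 2))).1)
      (K1.ofUnits (Talg Λ) v) = x.1 (Talg.kerProj (hΛ.jacobsonPow (n + 2))) ∧
      Talg.proj (hΛ.jacobsonPow (n + 1)) v = Talg.proj (hΛ.jacobsonPow (n + 1)) u := by
  have hle := Talg.kerProj_mono (hΛ.jacobsonPow_anti (Nat.le_succ (n + 1)))
  have hle1 := Talg.kerProj_mono (hΛ.jacobsonPow_anti (Nat.le_add_left 1 n))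
  -- an element of `Λ⟨T⟩` that is `1` modulo the smaller power is a unit
  have hunit : ∀ a : Talg Λ, OpenIdeal.proj hle (Ideal.Quotient.mk _ a) = 1 → IsUnit a := by
    intro a ha
    refine Talg.isUnit_of_mk_eq_one hΛ a ?_
    have := congrArg (OpenIdeal.proj hle1) ha
    rwa [map_one] at this
  obtain ⟨w, hw1, hw⟩ := K1.exists_ofUnits_eq_of_map_eq_one (f := OpenIdeal.proj hle)
    (Ideal.Quotient.factor_surjective hle)
    (fun r hr => by
      obtain ⟨a, rfl⟩ := Ideal.Quotient.mk_surjective r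
      exact (hunit a hr).map _)
    (x := x.1 (Talg.kerProj (hΛ.jacobsonPow (n + 2))) *
      (K1.map (Ideal.Quotient.mk _) (K1.ofUnits (Talg Λ) u))⁻¹)
    (by
      rw [map_mul, map_inv, x.2 _ _ hle, K1.map_comp_apply, OpenIdeal.proj,
        Ideal.Quotient.factor_comp_mk, hu, mul_inv_cancel])
  obtain ⟨a, ha⟩ := Ideal.Quotient.mk_surjective w.val
  obtain ⟨b, rfl⟩ := hunit a (by rw [ha, hw1])
  refine ⟨b * u, ?_, ?_⟩
  · have hb : Units.map (Ideal.Quotient.mk (Talg.kerProj (hΛ.jacobsonPow (n + 2))).1 :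
        Talg Λ →* _) b = w := Units.ext ha
    rw [map_mul, map_mul, K1.map_ofUnits, hb, hw, inv_mul_cancel_right]
  · rw [← ha] at hw1
    have : Ideal.Quotient.mk (Talg.kerProj (hΛ.jacobsonPow (n + 1))).1 (b : Talg Λ) =
        Ideal.Quotient.mk _ 1 := hw1
    rw [Talg.mk_kerProj_eq_iff, map_one] at this
    rw [Units.val_mul, map_mul, this, one_mul]

/-- A sequence of elements of `Λ⟨T⟩` that stabilizes modulo each power of the Jacobson radical
converges. -/
theorem Talg.exists_limit (hΛ : IsAdicRing Λ) (u : ℕ → Talg Λ)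
    (hu : ∀ n, Talg.proj (hΛ.jacobsonPow (n + 1)) (u (n + 1)) =
      Talg.proj (hΛ.jacobsonPow (n + 1)) (u n)) :
    ∃ a, ∀ n, Talg.proj (hΛ.jacobsonPow (n + 1)) a = Talg.proj (hΛ.jacobsonPow (n + 1)) (u n) := by
  have hstab : ∀ (I : OpenIdeal Λ) (n k : ℕ), hΛ.jacobsonPow (n + 1) ≤ I → n ≤ k →
      Talg.proj I (u k) = Talg.proj I (u n) := by
    intro I n k hn hk
    induction k, hk using Nat.le_induction with
    | base => rfl
    | succ k hk ih =>
      rw [← ih, ← Talg.map_proj ((hΛ.jacobsonPow_anti (Nat.succ_le_succ hk)).trans hn), hu k,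
        Talg.map_proj]
  have hstab' : ∀ (I : OpenIdeal Λ) (n k : ℕ), hΛ.jacobsonPow (n + 1) ≤ I →
      hΛ.jacobsonPow (k + 1) ≤ I → Talg.proj I (u n) = Talg.proj I (u k) := by
    intro I n k hn hk
    rw [← hstab I n _ hn (le_max_left n k), ← hstab I k _ hk (le_max_right n k)]
  choose m hm using hΛ.exists_jacobsonPow_le
  obtain ⟨a, ha⟩ := Talg.exists_proj_eq (fun I => Talg.proj I (u (m I))) fun I J h => by
    rw [Talg.map_proj]
    exact hstab' J _ _ ((hm I).trans h) (hm J)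
  exact ⟨a, fun n => by rw [ha]; exact hstab' _ _ _ (hm _) le_rfl⟩

theorem Talg.surjective_toCompleted (hΛ : IsAdicRing Λ) :
    Function.Surjective (K1.toCompleted (Talg Λ)) := by
  intro x
  let rep (n : ℕ) (u : (Talg Λ)ˣ) : Prop :=
    K1.map (Ideal.Quotient.mk (Talg.kerProj (hΛ.jacobsonPow (n + 1))).1)
      (K1.ofUnits (Talg Λ) u) = x.1 (Talg.kerProj (hΛ.jacobsonPow (n + 1)))
  have h0 : ∃ u, rep 0 u := by
    obtain ⟨v, hv⟩ := (Talg.unitsGenerate_quotient hΛ).surjective_ofUnits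
      (x.1 (Talg.kerProj (hΛ.jacobsonPow 1)))
    obtain ⟨r, hr⟩ := Ideal.Quotient.mk_surjective v.val
    obtain ⟨u, rfl⟩ := isUnit_of_isUnit_map Ideal.Quotient.mk_surjective
      (Talg.isUnit_of_mk_eq_one hΛ) (hr ▸ v.isUnit)
    refine ⟨u, ?_⟩
    change K1.map _ _ = _
    rw [K1.map_ofUnits, ← hv]
    exact congrArg _ (Units.ext hr)
  obtain ⟨u₀, hu₀⟩ := h0
  choose next hnext hnext' using fun n (u : {u // rep n u}) =>
    Talg.exists_unit_lift hΛ x n u.1 u.2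
  let u : ∀ n, {u // rep n u} := fun n =>
    Nat.rec ⟨u₀, hu₀⟩ (fun n v => ⟨next n v, hnext n v⟩) n
  obtain ⟨a, ha⟩ := Talg.exists_limit hΛ (fun n => ((u n).1 : Talg Λ)) fun n => hnext' n (u n)
  obtain ⟨a, rfl⟩ := isUnit_of_isUnit_map Ideal.Quotient.mk_surjective
    (Talg.isUnit_of_mk_eq_one hΛ) (r := a) (by
      rw [Talg.mk_kerProj_eq_iff.2 (ha 0)]
      exact (u 0).1.isUnit.map _)
  refine ⟨K1.ofUnits _ a, Subtype.ext (funext fun 𝔟 => ?_)⟩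
  obtain ⟨n, hn⟩ := Talg.exists_kerProj_le hΛ 𝔟
  have hau : K1.map (Ideal.Quotient.mk (Talg.kerProj (hΛ.jacobsonPow (n + 1))).1)
      (K1.ofUnits (Talg Λ) a) = x.1 (Talg.kerProj (hΛ.jacobsonPow (n + 1))) := by
    rw [← (u n).2, K1.map_ofUnits, K1.map_ofUnits]
    exact congrArg _ (Units.ext (Talg.mk_kerProj_eq_iff.2 (ha n)))
  rw [← x.2 _ _ hn, ← hau, K1.map_comp_apply, OpenIdeal.proj, Ideal.Quotient.factor_comp_mk]
  rfl

end Main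

end

theorem mainTheorem10 (Λ : Type u) [Ring Λ] [TopologicalSpace Λ] (hΛ : IsAdicRing Λ) :
    Function.Surjective (K1.ofUnits (Talg Λ)) ∧
      Function.Surjective (K1.toCompleted (Talg Λ)) :=
  ⟨Talg.surjective_ofUnits hΛ, Talg.surjective_toCompleted hΛ⟩
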